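/- Let $L,\kappa,\epsilon>0$, $0<\alpha<1$, let $M\ge 1$ be an integer and $h:=L/M$. Let $\mathbb V_h$ be the space of real grid functions $v=(v_{ij})_{i,j\in\mathbb Z}$ that are $M$-periodic in both indices ($v_{ij}$ is the value at $(ih,jh)$), with $$\langle v,w\rangle:=h^2\sum_{i,j=1}^{M}v_{ij}w_{ij},\qquad \|v\|:=\sqrt{\langle v,v\rangle},$$ $$\Delta_h v_{ij}:=\frac{v_{i+1,j}+v_{i-1,j}+v_{i,j+1}+v_{i,j-1}-4v_{ij}}{h^2},\qquad \|\nabla_h v\|^2:=h^2\sum_{i,j=1}^{M}\left[\Big(\frac{v_{i+1,j}-v_{ij}}{h}\Big)^2+\Big(\frac{v_{i,j+1}-v_{ij}}{h}\Big)^2\right].$$ Let $0=t_0<t_1<\dots<t_N=T$ be an arbitrary (nonuniform) time mesh with steps $\tau_n:=t_n-t_{n-1}$. With $\omega_\beta(s):=s^{\beta-1}/\Gamma(\beta)$, define the L1 kernels $$a_{n-k}^{(n)}:=\frac1{\tau_k}\int_{t_{k-1}}^{t_k}\omega_{1-\alpha}(t_n-s)\,ds,\qquad 1\le k\le n\le N,$$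 the discrete orthogonal convolution (DOC) kernels $$\theta_0^{(n)}:=\frac1{a_0^{(n)}},\qquad \theta_{n-k}^{(n)}:=-\frac1{a_0^{(k)}}\sum_{j=k+1}^{n}\theta_{n-j}^{(n)}a_{j-k}^{(j)}\quad(1\le k\le n-1),$$ and the discrete complementary convolution kernels $$p_{n-k}^{(n)}:=\sum_{j=k}^{n}\theta_{j-k}^{(j)}\quad(1\le k\le n).$$ Let $\phi^0,\dots,\phi^N\in\mathbb V_h$, with arbitrary initial value $\phi^0$, satisfy the implicit L1 scheme for the time-fractional Allen–Cahn equation, $$\sum_{k=1}^{n}a_{n-k}^{(n)}(\phi^k-\phi^{k-1})=-\kappa\mu^n,\qquad \mu^n:=(\phi^n)^3-\phi^n-\epsilon^2\Delta_h\phi^n,\qquad 1\le n\le N.$$ Define $$E[\phi^n]:=\frac{\epsilon^2}{2}\|\nabla_h\phi^n\|^2+\frac14\|(\phi^n)^2-1\|^2,\qquad \mathcal E_\alpha[\phi^n]:=E[\phi^n]+\frac{\kappa}{2}\sum_{j=1}^{n}p_{n-j}^{(n)}\|\mu^j\|^2\quad(0\le n\le N),$$ so that $\mathcal E_\alpha[\phi^0]=E[\phi^0]$.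 **Theorem 2.2.** If $$\tau_n\le\frac{1}{\sqrt[\alpha]{\kappa\,\Gamma(2-\alpha)}}\qquad\text{for } 1\le n\le N,$$ then $$\partial_\tau\mathcal E_\alpha[\phi^n]:=\frac{\mathcal E_\alpha[\phi^n]-\mathcal E_\alpha[\phi^{n-1}]}{\tau_n}\le 0\qquad\text{for } 1\le n\le N.$$ -/

import Mathlib

/-! ### Space discretization: periodic grid functions on the square -/

/-- Grid functions on the uniform grid with `M` cells in each of the two directions that are
periodic with period `M` in both indices: the value at the node `(i h, j h)` is `v (i, j)`, with
the indices taken modulo `M`. -/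
abbrev GridFun (M : ℕ) : Type := ZMod M × ZMod M → ℝ

/-- Discrete inner product `⟨v, w⟩ = h² ∑ v w`, the sum running over one full period. -/
noncomputable def gridInner {M : ℕ} [NeZero M] (h : ℝ) (v w : GridFun M) : ℝ :=
  h ^ 2 * ∑ x : ZMod M × ZMod M, v x * w x

/-- Discrete `L²` norm. -/
noncomputable def gridNorm {M : ℕ} [NeZero M] (h : ℝ) (v : GridFun M) : ℝ :=
  Real.sqrt (gridInner h v v)

/-- First component of the discrete gradient: the central difference at the midpoint of the edge
from `(i, j)` to `(i + 1, j)`, stored at `(i, j)`. -/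
noncomputable def gridGradX {M : ℕ} (h : ℝ) (v : GridFun M) : GridFun M :=
  fun x => (v (x.1 + 1, x.2) - v x) / h

/-- Second component of the discrete gradient: the central difference at the midpoint of the edge
from `(i, j)` to `(i, j + 1)`, stored at `(i, j)`. -/
noncomputable def gridGradY {M : ℕ} (h : ℝ) (v : GridFun M) : GridFun M :=
  fun x => (v (x.1, x.2 + 1) - v x) / h

/-- Discrete `L²` norm of the discrete gradient. -/
noncomputable def gridGradNorm {M : ℕ} [NeZero M] (h : ℝ) (v : GridFun M) : ℝ :=
  Real.sqrt (gridNorm h (gridGradX h v) ^ 2 + gridNorm h (gridGradY h v) ^ 2)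

/-- Five-point discrete Laplacian with periodic boundary conditions. -/
noncomputable def gridLaplacian {M : ℕ} (h : ℝ) (v : GridFun M) : GridFun M :=
  fun x => (v (x.1 + 1, x.2) + v (x.1 - 1, x.2) + v (x.1, x.2 + 1) + v (x.1, x.2 - 1) - 4 * v x)
    / h ^ 2

/-- Discrete chemical potential `μ = φ³ - φ - ε² Δ_h φ`. -/
noncomputable def potential {M : ℕ} (h ε : ℝ) (φ : GridFun M) : GridFun M :=
  fun x => φ x ^ 3 - φ x - ε ^ 2 * gridLaplacian h φ x

/-- Discrete Ginzburg-Landau energy `E[φ] = (ε²/2) ‖∇_h φ‖² + (1/4) ‖φ² - 1‖²`. -/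
noncomputable def freeEnergy {M : ℕ} [NeZero M] (h ε : ℝ) (φ : GridFun M) : ℝ :=
  ε ^ 2 / 2 * gridGradNorm h φ ^ 2 + 1 / 4 * gridNorm h (fun x => φ x ^ 2 - 1) ^ 2

/-! ### Time discretization on a nonuniform mesh -/

/-- Time step `τ_n = t_n - t_{n-1}`, used for `n ≥ 1`. -/
def timeStep (t : ℕ → ℝ) (n : ℕ) : ℝ := t n - t (n - 1)

/-- Backward difference quotient `∂_τ v^n = (v^n - v^{n-1}) / τ_n`, used for `n ≥ 1`. -/
noncomputable def backwardDiffQuot (t : ℕ → ℝ) (v : ℕ → ℝ) (n : ℕ) : ℝ :=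
  (v n - v (n - 1)) / timeStep t n

/-- The function `ω_β(s) = s^(β - 1) / Γ(β)`. -/
noncomputable def fracWeight (β s : ℝ) : ℝ := s ^ (β - 1) / Real.Gamma β

/-- L1 kernels of the Caputo derivative of order `α`. All discrete kernels are indexed by the pair
`(n, k)`, `1 ≤ k ≤ n`: the value at `(n, k)` is the kernel with superscript `(n)` and subscript
`n - k`, here `a_{n-k}^{(n)} = (1/τ_k) ∫_{t_{k-1}}^{t_k} ω_{1-α}(t_n - s) ds`. -/
noncomputable def l1Kernel (α : ℝ) (t : ℕ → ℝ) (n k : ℕ) : ℝ :=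
  1 / timeStep t k * ∫ s in (t (k - 1))..(t k), fracWeight (1 - α) (t n - s)

/-- L1 formula `(∂_τ^α v)^n = ∑_{k=1}^n a_{n-k}^{(n)} (v^k - v^{k-1})`, for a sequence of grid
functions. -/
noncomputable def l1Derivative {M : ℕ} (α : ℝ) (t : ℕ → ℝ) (v : ℕ → GridFun M) (n : ℕ) :
    GridFun M :=
  fun x => ∑ k ∈ Finset.Icc 1 n, l1Kernel α t n k * (v k x - v (k - 1) x)

/-- Discrete orthogonal convolution kernels of a kernel `a`; the value at `(n, k)` is
`θ_{n-k}^{(n)}`. For fixed `n` they are computed recursively for `k = n, n - 1, …, 1`, and only the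
values for `1 ≤ k ≤ n` are used. -/
noncomputable def docKernel (a : ℕ → ℕ → ℝ) (n k : ℕ) : ℝ :=
  if k < n then
    -(1 / a k k) * ∑ j ∈ (Finset.Icc (k + 1) n).attach, docKernel a n j.1 * a j.1 k
  else 1 / a n n
termination_by n - k
decreasing_by
  have hj := Finset.mem_Icc.mp j.2
  omega

/-- Starting value `θ_0^{(n)} = 1 / a_0^{(n)}`. -/
theorem docKernel_self (a : ℕ → ℕ → ℝ) (n : ℕ) : docKernel a n n = 1 / a n n := by
  rw [docKernel, if_neg (lt_irrefl n)]

/-- Recursion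
`θ_{n-k}^{(n)} = -(1 / a_0^{(k)}) ∑_{j=k+1}^n θ_{n-j}^{(n)} a_{j-k}^{(j)}` for `k < n`. -/
theorem docKernel_of_lt (a : ℕ → ℕ → ℝ) {n k : ℕ} (hk : k < n) :
    docKernel a n k =
      -(1 / a k k) * ∑ j ∈ Finset.Icc (k + 1) n, docKernel a n j * a j k := by
  rw [docKernel, if_pos hk,
    Finset.sum_attach (Finset.Icc (k + 1) n) (fun j => docKernel a n j * a j k)]

/-- Discrete complementary convolution kernels
`p_{n-k}^{(n)} = ∑_{j=k}^n θ_{j-k}^{(j)}`, for `1 ≤ k ≤ n`. -/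
noncomputable def dccKernel (a : ℕ → ℕ → ℝ) (n k : ℕ) : ℝ :=
  ∑ j ∈ Finset.Icc k n, docKernel a j k

/-- The grid functions `φ^0, …, φ^N` solve the implicit L1 scheme
`(∂_τ^α φ)^n = -κ μ^n`, `1 ≤ n ≤ N`, started from `φ^0`. -/
def IsL1Solution {M : ℕ} (h α κ ε : ℝ) (t : ℕ → ℝ) (N : ℕ) (φ : ℕ → GridFun M) : Prop :=
  ∀ n, 1 ≤ n → n ≤ N → ∀ x, l1Derivative α t φ n x = -κ * potential h ε (φ n) x

/-- Discrete variational energy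
`E[φ^n] + (κ/2) ∑_{j=1}^n p_{n-j}^{(n)} ‖μ^j‖²`; the sum is empty for `n = 0`. -/
noncomputable def variationalEnergy {M : ℕ} [NeZero M] (h α κ ε : ℝ) (t : ℕ → ℝ)
    (φ : ℕ → GridFun M) (n : ℕ) : ℝ :=
  freeEnergy h ε (φ n) +
    κ / 2 * ∑ j ∈ Finset.Icc 1 n,
      dccKernel (l1Kernel α t) n j * gridNorm h (potential h ε (φ j)) ^ 2

/-! Convolving the scheme with the DOC kernels inverts it at each node: the increment is `d = -κ ∑
θ_j μ^j` (`sum_docKernel_mul_sum`). The same row of weights gives the increment of the nonlocal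
energy, `κ/2 ∑ θ_j ‖μ^j‖²` (`sum_dccKernel_mul_sub`), while the free energy grows by at most `⟨μ^n,
d⟩ + ‖d‖²/2` (`freeEnergy_sub_le`). What remains is a scalar inequality at each node,
`dissipation_of_weights`.

It needs three facts about `θ`. Off-diagonal entries are nonpositive, because the ratios of adjacent
L1 columns are monotone in the row (`docKernel_nonpos`, `l1Kernel_mul_le_mul`). Row sums are
nonnegative, because the first L1 column decreases (`sum_docKernel_nonneg`). Finally `κ θ_0 ≤ 1`,
which is exactly the step restriction. -/

/-! ### Discrete orthogonal convolution kernels -/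

/-- Orthogonality of the DOC kernels and the original kernels, off the diagonal. -/
theorem sum_docKernel_mul_of_lt (a : ℕ → ℕ → ℝ) {n k : ℕ} (hk : k < n) (ha : a k k ≠ 0) :
    ∑ j ∈ Finset.Icc k n, docKernel a n j * a j k = 0 := by
  rw [← Finset.add_sum_Ioc_eq_sum_Icc hk.le, docKernel_of_lt a hk,
    ← Finset.Icc_add_one_left_eq_Ioc]
  field_simp
  ring

/-- Orthogonality of the DOC kernels and the original kernels, on the diagonal. -/
theorem sum_docKernel_mul_self (a : ℕ → ℕ → ℝ) (n : ℕ) (ha : a n n ≠ 0) :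
    ∑ j ∈ Finset.Icc n n, docKernel a n j * a j n = 1 := by
  rw [Finset.Icc_self, Finset.sum_singleton, docKernel_self, one_div, inv_mul_cancel₀ ha]

/-- The DOC kernels invert the discrete convolution with the original kernels. -/
theorem sum_docKernel_mul_sum (a : ℕ → ℕ → ℝ) (d : ℕ → ℝ) {n : ℕ} (hn : 1 ≤ n)
    (ha : ∀ k, 1 ≤ k → k ≤ n → a k k ≠ 0) :
    ∑ j ∈ Finset.Icc 1 n, docKernel a n j * ∑ k ∈ Finset.Icc 1 j, a j k * d k = d n := by
  simp_rw [Finset.mul_sum]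
  rw [Finset.sum_comm' (t' := Finset.Icc 1 n) (s' := fun k => Finset.Icc k n)
    (fun j k => by simp only [Finset.mem_Icc]; omega)]
  simp_rw [← mul_assoc, ← Finset.sum_mul]
  rw [Finset.sum_eq_single_of_mem n (by simp [hn])]
  · rw [sum_docKernel_mul_self a n (ha n hn le_rfl), one_mul]
  · intro k hk hkn
    rw [Finset.mem_Icc] at hk
    rw [sum_docKernel_mul_of_lt a (by omega) (ha k hk.1 hk.2), zero_mul]

/-- If the kernels are positive and the ratio of consecutive columns increases along the rows,
the off-diagonal DOC kernels are nonpositive. -/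
theorem docKernel_nonpos (a : ℕ → ℕ → ℝ) {n : ℕ}
    (hpos : ∀ j k, 1 ≤ k → k ≤ j → j ≤ n → 0 < a j k)
    (hratio : ∀ j k, 1 ≤ k → k < j → j < n → a j k * a n (k + 1) ≤ a n k * a j (k + 1))
    {k : ℕ} (hk : 1 ≤ k) (hkn : k < n) : docKernel a n k ≤ 0 := by
  induction hm : n - k using Nat.strong_induction_on generalizing k with
  | _ m ih =>
  have hkk := hpos k k hk le_rfl hkn.le
  rw [docKernel_of_lt a hkn, neg_mul, neg_nonpos]
  refine mul_nonneg (by positivity) ?_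
  have hn1 := hpos n (k + 1) (by omega) (by omega) le_rfl
  rcases Nat.lt_or_ge (k + 1) n with h1 | h1
  · have horth := sum_docKernel_mul_of_lt a h1 (hpos _ _ (by omega) le_rfl h1.le).ne'
    -- Subtracting a multiple of the vanishing pairing with column `k + 1` cancels the term `j = n`,
    -- the only one with positive `θ`; every other term is a product of two nonpositive factors.
    have key : 0 ≤ ∑ j ∈ Finset.Icc (k + 1) n,
        docKernel a n j * (a j k * a n (k + 1) - a n k * a j (k + 1)) := by
      refine Finset.sum_nonneg fun j hj => ?_
      rw [Finset.mem_Icc] at hj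
      rcases hj.2.lt_or_eq with hjn | rfl
      · exact mul_nonneg_of_nonpos_of_nonpos (ih (n - j) (by omega) (by omega) hjn rfl)
          (sub_nonpos.mpr (hratio j k hk (by omega) hjn))
      · simp
    have hsplit : ∑ j ∈ Finset.Icc (k + 1) n,
        docKernel a n j * (a j k * a n (k + 1) - a n k * a j (k + 1)) =
        (∑ j ∈ Finset.Icc (k + 1) n, docKernel a n j * a j k) * a n (k + 1) -
        a n k * ∑ j ∈ Finset.Icc (k + 1) n, docKernel a n j * a j (k + 1) := by
      rw [Finset.sum_mul, Finset.mul_sum, ← Finset.sum_sub_distrib]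
      exact Finset.sum_congr rfl fun j _ => by ring
    rw [hsplit, horth, mul_zero, sub_zero] at key
    exact nonneg_of_mul_nonneg_left key hn1
  · obtain rfl : n = k + 1 := by omega
    rw [Finset.Icc_self, Finset.sum_singleton, docKernel_self]
    have := hpos (k + 1) k hk (by omega) le_rfl
    positivity

/-- If moreover the first column of the kernels is decreasing, the DOC kernels have nonnegative
row sums. -/
theorem sum_docKernel_nonneg (a : ℕ → ℕ → ℝ) {n : ℕ} (hn : 1 ≤ n)
    (hpos : ∀ j k, 1 ≤ k → k ≤ j → j ≤ n → 0 < a j k)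
    (hanti : ∀ j, 1 ≤ j → j < n → a n 1 ≤ a j 1)
    (hθ : ∀ k, 1 ≤ k → k < n → docKernel a n k ≤ 0) :
    0 ≤ ∑ j ∈ Finset.Icc 1 n, docKernel a n j := by
  have horth : 0 ≤ ∑ j ∈ Finset.Icc 1 n, docKernel a n j * a j 1 := by
    have h11 := (hpos 1 1 le_rfl le_rfl hn).ne'
    rcases hn.lt_or_eq with h1 | rfl
    · rw [sum_docKernel_mul_of_lt a h1 h11]
    · rw [sum_docKernel_mul_self a 1 h11]
      exact zero_le_one
  -- Lowering `a j 1` to `a n 1` only increases the pairing with the first column, since the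
  -- affected `θ` are nonpositive.
  refine nonneg_of_mul_nonneg_left (horth.trans ?_) (hpos n 1 le_rfl hn le_rfl)
  rw [Finset.sum_mul]
  refine Finset.sum_le_sum fun j hj => ?_
  rw [Finset.mem_Icc] at hj
  rcases hj.2.lt_or_eq with hjn | rfl
  · exact mul_le_mul_of_nonpos_left (hanti j hj.1 hjn) (hθ j hj.1 hjn)
  · exact le_rfl

/-- Increments of a convolution with the complementary kernels. -/
theorem sum_dccKernel_mul_sub (a : ℕ → ℕ → ℝ) (g : ℕ → ℝ) {n : ℕ} (hn : 1 ≤ n) :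
    ∑ j ∈ Finset.Icc 1 n, dccKernel a n j * g j -
      ∑ j ∈ Finset.Icc 1 (n - 1), dccKernel a (n - 1) j * g j =
    ∑ j ∈ Finset.Icc 1 n, docKernel a n j * g j := by
  obtain ⟨m, rfl⟩ : ∃ m, n = m + 1 := ⟨n - 1, by omega⟩
  have hz : dccKernel a m (m + 1) = 0 := by simp [dccKernel]
  have hext : ∑ j ∈ Finset.Icc 1 m, dccKernel a m j * g j =
      ∑ j ∈ Finset.Icc 1 (m + 1), dccKernel a m j * g j := by
    rw [Finset.sum_Icc_succ_top (by omega), hz, zero_mul, add_zero]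
  rw [Nat.add_sub_cancel, hext, ← Finset.sum_sub_distrib]
  refine Finset.sum_congr rfl fun j hj => ?_
  rw [Finset.mem_Icc] at hj
  rw [← sub_mul, dccKernel, dccKernel, Finset.sum_Icc_succ_top hj.2, add_sub_cancel_left]

/-! ### Kernels of the L1 formula -/

theorem fracWeight_pos {α s : ℝ} (hα1 : α < 1) (hs : 0 < s) : 0 < fracWeight (1 - α) s :=
  div_pos (Real.rpow_pos_of_pos hs _) (Real.Gamma_pos_of_pos (by linarith))

theorem fracWeight_anti {α x y : ℝ} (hα0 : 0 < α) (hα1 : α < 1) (hx : 0 < x) (hxy : x ≤ y) :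
    fracWeight (1 - α) y ≤ fracWeight (1 - α) x :=
  div_le_div_of_nonneg_right (Real.rpow_le_rpow_of_nonpos hx hxy (by linarith))
    (Real.Gamma_pos_of_pos (by linarith)).le

/-- The ratio `ω(y) / ω(x)` grows when both arguments are shifted to the right, `x ≤ y`. -/
theorem fracWeight_mul_le_mul {α x y δ : ℝ} (hα0 : 0 < α) (hx : 0 < x) (hxy : x ≤ y)
    (hδ : 0 ≤ δ) :
    fracWeight (1 - α) (x + δ) * fracWeight (1 - α) y ≤
      fracWeight (1 - α) (y + δ) * fracWeight (1 - α) x := by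
  have hy : 0 < y := hx.trans_le hxy
  simp only [fracWeight]
  rw [div_mul_div_comm, div_mul_div_comm, ← Real.mul_rpow (by positivity) hy.le,
    ← Real.mul_rpow (by positivity) hx.le]
  refine div_le_div_of_nonneg_right ?_ (mul_self_nonneg _)
  -- The exponent is `-α`, so the claim is `(y + δ) x ≤ (x + δ) y`, that is `δ x ≤ δ y`.
  refine Real.rpow_le_rpow_of_nonpos (by positivity) ?_ (by linarith)
  nlinarith

theorem intervalIntegrable_fracWeight {α : ℝ} (hα1 : α < 1) (c a b : ℝ) :
    IntervalIntegrable (fun s => fracWeight (1 - α) (c - s)) MeasureTheory.volume a b := by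
  have h : IntervalIntegrable (fun x : ℝ => x ^ (1 - α - 1)) MeasureTheory.volume
      (c - a) (c - b) := intervalIntegral.intervalIntegrable_rpow' (by linarith)
  simpa [fracWeight] using (h.comp_sub_left c).div_const (Real.Gamma (1 - α))

theorem l1Kernel_pos {α : ℝ} (hα1 : α < 1) {t : ℕ → ℝ} {n k : ℕ}
    (hk : t (k - 1) < t k) (hkn : t k ≤ t n) : 0 < l1Kernel α t n k := by
  refine mul_pos (one_div_pos.mpr (sub_pos.mpr hk)) ?_
  exact intervalIntegral.intervalIntegral_pos_of_pos_on (intervalIntegrable_fracWeight hα1 _ _ _)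
    (fun s hs => fracWeight_pos hα1 (by linarith [hs.2])) hk

/-- Makes `θ_0 = Γ(2 - α) τ_n^α` explicit, to be compared with the step restriction. -/
theorem l1Kernel_self {α : ℝ} (hα1 : α < 1) {t : ℕ → ℝ} {n : ℕ} (hn : t (n - 1) < t n) :
    l1Kernel α t n n = 1 / (Real.Gamma (2 - α) * timeStep t n ^ α) := by
  have hτ : 0 < timeStep t n := sub_pos.mpr hn
  have hΓ : Real.Gamma (2 - α) = (1 - α) * Real.Gamma (1 - α) := by
    rw [← Real.Gamma_add_one (by linarith)]
    congr 1
    ring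
  have hG : 0 < Real.Gamma (1 - α) := Real.Gamma_pos_of_pos (by linarith)
  have hsplit : timeStep t n = timeStep t n ^ α * timeStep t n ^ (1 - α) := by
    rw [← Real.rpow_add hτ]
    simp
  have hpos1 : 0 < timeStep t n ^ α := Real.rpow_pos_of_pos hτ _
  have hpos2 : 0 < timeStep t n ^ (1 - α) := Real.rpow_pos_of_pos hτ _
  have h1 : (1 - α) ≠ 0 := by linarith
  have hint : ∫ s in (t (n - 1))..(t n), fracWeight (1 - α) (t n - s) =
      timeStep t n ^ (1 - α) / (1 - α) / Real.Gamma (1 - α) := by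
    rw [intervalIntegral.integral_comp_sub_left (fun s => fracWeight (1 - α) s)]
    simp only [fracWeight]
    rw [intervalIntegral.integral_div, integral_rpow (Or.inl (by linarith)), sub_self,
      sub_add_cancel, Real.zero_rpow h1, sub_zero, timeStep]
  rw [l1Kernel, hint, hΓ]
  nth_rewrite 1 [hsplit]
  field_simp

theorem l1Kernel_anti {α : ℝ} (hα0 : 0 < α) (hα1 : α < 1) {t : ℕ → ℝ} {n j k : ℕ}
    (hk : t (k - 1) < t k) (hkj : t k ≤ t j) (hjn : t j ≤ t n) :
    l1Kernel α t n k ≤ l1Kernel α t j k := by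
  refine mul_le_mul_of_nonneg_left ?_ (one_div_pos.mpr (sub_pos.mpr hk)).le
  -- The open interval matters: for `j = k` the weight is singular at `s = t k`, where `Real.rpow`
  -- returns `0`.
  exact intervalIntegral.integral_mono_on_of_le_Ioo hk.le
    (intervalIntegrable_fracWeight hα1 _ _ _) (intervalIntegrable_fracWeight hα1 _ _ _)
    fun s hs => fracWeight_anti hα0 hα1 (by linarith [hs.2]) (by linarith)

/-- The ratio of the weights seen from `t n` and `t j` is monotone in `s`, so its value `B / A` at
the common node `t k` separates its averages over the two adjacent cells. -/
theorem l1Kernel_mul_le_mul {α : ℝ} (hα0 : 0 < α) (hα1 : α < 1) {t : ℕ → ℝ} {n j k : ℕ}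
    (hk : t (k - 1) < t k) (hk1 : t k < t (k + 1)) (hkj : t (k + 1) ≤ t j) (hjn : t j ≤ t n) :
    l1Kernel α t j k * l1Kernel α t n (k + 1) ≤ l1Kernel α t n k * l1Kernel α t j (k + 1) := by
  set A := fracWeight (1 - α) (t j - t k) with hA
  set B := fracWeight (1 - α) (t n - t k) with hB
  have hApos : 0 < A := fracWeight_pos hα1 (by linarith)
  have hBpos : 0 < B := fracWeight_pos hα1 (by linarith)
  have hleft : l1Kernel α t j k * B ≤ l1Kernel α t n k * A := by
    rw [l1Kernel, l1Kernel, mul_assoc, mul_assoc, ← intervalIntegral.integral_mul_const,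
      ← intervalIntegral.integral_mul_const]
    refine mul_le_mul_of_nonneg_left ?_ (one_div_pos.mpr (sub_pos.mpr hk)).le
    refine intervalIntegral.integral_mono_on_of_le_Ioo hk.le
      ((intervalIntegrable_fracWeight hα1 _ _ _).mul_const _)
      ((intervalIntegrable_fracWeight hα1 _ _ _).mul_const _) fun s hs => ?_
    have := fracWeight_mul_le_mul (α := α) (x := t j - t k) (y := t n - t k) (δ := t k - s) hα0
      (by linarith) (by linarith) (by linarith [hs.2])
    simpa [hA, hB] using this
  have hright : l1Kernel α t n (k + 1) * A ≤ l1Kernel α t j (k + 1) * B := by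
    rw [l1Kernel, l1Kernel, mul_assoc, mul_assoc, ← intervalIntegral.integral_mul_const,
      ← intervalIntegral.integral_mul_const, Nat.add_sub_cancel]
    refine mul_le_mul_of_nonneg_left ?_ (one_div_pos.mpr (sub_pos.mpr (by simpa using hk1))).le
    refine intervalIntegral.integral_mono_on_of_le_Ioo hk1.le
      ((intervalIntegrable_fracWeight hα1 _ _ _).mul_const _)
      ((intervalIntegrable_fracWeight hα1 _ _ _).mul_const _) fun s hs => ?_
    have := fracWeight_mul_le_mul (α := α) (x := t j - s) (y := t n - s) (δ := s - t k) hα0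
      (by linarith [hs.2]) (by linarith) (by linarith [hs.1])
    rw [show t j - s + (s - t k) = t j - t k by ring,
      show t n - s + (s - t k) = t n - t k by ring, ← hA, ← hB] at this
    linarith
  have h1 : 0 < l1Kernel α t n (k + 1) := l1Kernel_pos hα1 (by simpa using hk1) (by linarith)
  have h2 : 0 < l1Kernel α t n k := l1Kernel_pos hα1 hk (by linarith)
  have hmul := mul_le_mul hleft hright (by positivity) (by positivity)
  refine le_of_mul_le_mul_right ?_ (mul_pos hApos hBpos)
  linarith

/-- The step size restriction in terms of the leading kernel. -/
theorem mul_Gamma_mul_rpow_le_one {α κ τ : ℝ} (hα0 : 0 < α) (hα1 : α < 1) (hκ : 0 < κ)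
    (hτ : 0 ≤ τ) (h : τ ≤ 1 / (κ * Real.Gamma (2 - α)) ^ (1 / α)) :
    κ * (Real.Gamma (2 - α) * τ ^ α) ≤ 1 := by
  have hc : 0 < κ * Real.Gamma (2 - α) := mul_pos hκ (Real.Gamma_pos_of_pos (by linarith))
  have hp := Real.rpow_le_rpow hτ h hα0.le
  rw [Real.div_rpow zero_le_one (by positivity), Real.one_rpow, ← Real.rpow_mul hc.le,
    one_div_mul_cancel hα0.ne', Real.rpow_one, le_div_iff₀ hc] at hp
  linarith

/-! ### Energy estimates -/

theorem gridNorm_sq {M : ℕ} [NeZero M] (h : ℝ) (v : GridFun M) :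
    gridNorm h v ^ 2 = h ^ 2 * ∑ x, v x ^ 2 := by
  rw [gridNorm, gridInner, Real.sq_sqrt]
  · simp_rw [sq (v _)]
  · exact mul_nonneg (sq_nonneg _) (Finset.sum_nonneg fun x _ => mul_self_nonneg _)

theorem gridGradNorm_sq {M : ℕ} [NeZero M] (h : ℝ) (v : GridFun M) :
    gridGradNorm h v ^ 2 = h ^ 2 * ∑ x, (gridGradX h v x ^ 2 + gridGradY h v x ^ 2) := by
  rw [gridGradNorm, Real.sq_sqrt (by positivity), gridNorm_sq, gridNorm_sq,
    Finset.sum_add_distrib, mul_add]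

/-- Summation by parts on the periodic grid. -/
theorem sum_grad_mul_grad {M : ℕ} [NeZero M] (h : ℝ) (v w : GridFun M) :
    ∑ x, (gridGradX h v x * gridGradX h w x + gridGradY h v x * gridGradY h w x) =
      -∑ x, gridLaplacian h v x * w x := by
  have hX : ∑ x : ZMod M × ZMod M, (v (x.1 + 1, x.2) - v x) * w (x.1 + 1, x.2) =
      ∑ x : ZMod M × ZMod M, (v x - v (x.1 - 1, x.2)) * w x :=
    Fintype.sum_equiv ((Equiv.addRight (1 : ZMod M)).prodCongr (Equiv.refl _)) _ _
      fun x => by simp [Prod.map]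
  have hY : ∑ x : ZMod M × ZMod M, (v (x.1, x.2 + 1) - v x) * w (x.1, x.2 + 1) =
      ∑ x : ZMod M × ZMod M, (v x - v (x.1, x.2 - 1)) * w x :=
    Fintype.sum_equiv ((Equiv.refl _).prodCongr (Equiv.addRight (1 : ZMod M))) _ _
      fun x => by simp [Prod.map]
  calc ∑ x, (gridGradX h v x * gridGradX h w x + gridGradY h v x * gridGradY h w x)
      = (∑ x : ZMod M × ZMod M, (v (x.1 + 1, x.2) - v x) * w (x.1 + 1, x.2) +
          ∑ x : ZMod M × ZMod M, (v (x.1, x.2 + 1) - v x) * w (x.1, x.2 + 1) -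
          ∑ x : ZMod M × ZMod M,
            ((v (x.1 + 1, x.2) - v x) * w x + (v (x.1, x.2 + 1) - v x) * w x)) / h ^ 2 := by
        rw [← Finset.sum_add_distrib, ← Finset.sum_sub_distrib, Finset.sum_div]
        refine Finset.sum_congr rfl fun x _ => ?_
        simp only [gridGradX, gridGradY]
        ring
    _ = -∑ x, gridLaplacian h v x * w x := by
        rw [hX, hY, ← Finset.sum_add_distrib, ← Finset.sum_sub_distrib, Finset.sum_div,
          ← Finset.sum_neg_distrib]
        refine Finset.sum_congr rfl fun x _ => ?_
        simp only [gridLaplacian]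
        ring

/-- The Ginzburg-Landau energy is convex up to a quadratic perturbation. -/
theorem freeEnergy_sub_le {M : ℕ} [NeZero M] (h ε : ℝ) (φ ψ : GridFun M) :
    freeEnergy h ε φ - freeEnergy h ε ψ ≤
      h ^ 2 * ∑ x, (potential h ε φ x * (φ x - ψ x) + (φ x - ψ x) ^ 2 / 2) := by
  have hparts := sum_grad_mul_grad h φ (φ - ψ)
  have hgrad : ∑ x, (gridGradX h φ x ^ 2 + gridGradY h φ x ^ 2) -
      ∑ x, (gridGradX h ψ x ^ 2 + gridGradY h ψ x ^ 2) ≤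
      2 * ∑ x, (gridGradX h φ x * gridGradX h (φ - ψ) x +
        gridGradY h φ x * gridGradY h (φ - ψ) x) := by
    rw [← Finset.sum_sub_distrib, Finset.mul_sum]
    refine Finset.sum_le_sum fun x _ => ?_
    have hx : gridGradX h (φ - ψ) x = gridGradX h φ x - gridGradX h ψ x := by
      simp only [gridGradX, Pi.sub_apply]
      ring
    have hy : gridGradY h (φ - ψ) x = gridGradY h φ x - gridGradY h ψ x := by
      simp only [gridGradY, Pi.sub_apply]
      ring
    rw [hx, hy]
    nlinarith [sq_nonneg (gridGradX h φ x - gridGradX h ψ x),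
      sq_nonneg (gridGradY h φ x - gridGradY h ψ x)]
  have hbulk : 1 / 4 * (∑ x, (φ x ^ 2 - 1) ^ 2 - ∑ x, (ψ x ^ 2 - 1) ^ 2) ≤
      ∑ x, ((φ x ^ 3 - φ x) * (φ x - ψ x) + (φ x - ψ x) ^ 2 / 2) := by
    rw [← Finset.sum_sub_distrib, Finset.mul_sum]
    refine Finset.sum_le_sum fun x _ => ?_
    -- The quadratic terms cancel exactly; the gap is `(φ - ψ)² (2 φ² + (φ + ψ)²) / 4`.
    nlinarith [mul_nonneg (sq_nonneg (φ x - ψ x)) (sq_nonneg (φ x)),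
      mul_nonneg (sq_nonneg (φ x - ψ x)) (sq_nonneg (φ x + ψ x)),
      sq_nonneg (φ x ^ 2 - ψ x ^ 2), sq_nonneg (φ x * (φ x - ψ x))]
  have hsplit : ∑ x, (potential h ε φ x * (φ x - ψ x) + (φ x - ψ x) ^ 2 / 2) =
      ∑ x, ((φ x ^ 3 - φ x) * (φ x - ψ x) + (φ x - ψ x) ^ 2 / 2) -
        ε ^ 2 * ∑ x, gridLaplacian h φ x * (φ - ψ) x := by
    rw [Finset.mul_sum, ← Finset.sum_sub_distrib]
    refine Finset.sum_congr rfl fun x _ => ?_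
    simp only [potential, Pi.sub_apply]
    ring
  rw [freeEnergy, freeEnergy, gridGradNorm_sq, gridGradNorm_sq, gridNorm_sq, gridNorm_sq, hsplit]
  have hε := mul_le_mul_of_nonneg_left hgrad (sq_nonneg ε)
  rw [hparts] at hε
  nlinarith [mul_le_mul_of_nonneg_left hbulk (sq_nonneg h),
    mul_le_mul_of_nonneg_left hε (sq_nonneg h)]

/-- Discrete gradient structure: for weights `θ` that are nonpositive off the last index and have a
nonnegative sum, the increment `d = -κ ∑ θ m` satisfies a dissipation inequality. -/
theorem dissipation_of_weights {κ d : ℝ} (hκ : 0 < κ) {n : ℕ} (hn : 1 ≤ n) (θ m : ℕ → ℝ)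
    (hθ : ∀ k, 1 ≤ k → k < n → θ k ≤ 0) (hsum : 0 ≤ ∑ j ∈ Finset.Icc 1 n, θ j)
    (hθn : κ * θ n ≤ 1) (hd : d = -κ * ∑ j ∈ Finset.Icc 1 n, θ j * m j) :
    m n * d + d ^ 2 / 2 + κ / 2 * ∑ j ∈ Finset.Icc 1 n, θ j * m j ^ 2 ≤ 0 := by
  -- With the reference value `m n + d`, the term `j = n` is `θ n * d ^ 2`, and since `κ ∑ θ m = -d`
  -- the cross term, times `κ`, is `2 (m n + d) d`. Its `2 d²` absorbs the `d²` needed for the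
  -- nonconvex part and the `κ θ n d² ≤ d²` on the right.
  have hle : ∑ j ∈ Finset.Icc 1 n, θ j * (m n + d - m j) ^ 2 ≤ θ n * d ^ 2 := by
    rw [← Finset.sum_Ico_add_eq_sum_Icc hn]
    have : ∑ j ∈ Finset.Ico 1 n, θ j * (m n + d - m j) ^ 2 ≤ 0 :=
      Finset.sum_nonpos fun j hj => mul_nonpos_of_nonpos_of_nonneg
        (hθ j (Finset.mem_Ico.mp hj).1 (Finset.mem_Ico.mp hj).2) (sq_nonneg _)
    rw [add_sub_cancel_left]
    linarith
  have hexp : ∑ j ∈ Finset.Icc 1 n, θ j * (m n + d - m j) ^ 2 =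
      (∑ j ∈ Finset.Icc 1 n, θ j) * (m n + d) ^ 2 -
      2 * (m n + d) * ∑ j ∈ Finset.Icc 1 n, θ j * m j + ∑ j ∈ Finset.Icc 1 n, θ j * m j ^ 2 := by
    rw [Finset.sum_mul, Finset.mul_sum, ← Finset.sum_sub_distrib, ← Finset.sum_add_distrib]
    exact Finset.sum_congr rfl fun j _ => by ring
  rw [hexp] at hle
  have hS := mul_nonneg hsum (sq_nonneg (m n + d))
  set V := ∑ j ∈ Finset.Icc 1 n, θ j * m j
  set Q := ∑ j ∈ Finset.Icc 1 n, θ j * m j ^ 2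
  have h1 : κ * (Q - 2 * (m n + d) * V) ≤ κ * (θ n * d ^ 2) :=
    mul_le_mul_of_nonneg_left (by linarith) hκ.le
  have h2 : κ * θ n * d ^ 2 ≤ 1 * d ^ 2 := mul_le_mul_of_nonneg_right hθn (sq_nonneg d)
  have h3 : (m n + d) * d = -(κ * (m n + d) * V) := by
    nth_rewrite 2 [hd]
    ring
  nlinarith

/-- The variable-step L1 scheme for the time-fractional Allen-Cahn equation on the periodic square
of side `L`, with `M` cells of width `L / M` in each direction, dissipates the discrete variational
energy at each time level. -/
theorem theorem2p2 (L : ℝ) (hL : 0 < L) (M : ℕ) [NeZero M]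
    (α : ℝ) (hα0 : 0 < α) (hα1 : α < 1) (κ : ℝ) (hκ : 0 < κ) (ε : ℝ) (hε : 0 < ε)
    (T : ℝ) (N : ℕ) (t : ℕ → ℝ) (ht0 : t 0 = 0) (htN : t N = T)
    (htlt : ∀ n, 1 ≤ n → n ≤ N → t (n - 1) < t n)
    (hstep : ∀ n, 1 ≤ n → n ≤ N →
      timeStep t n ≤ 1 / (κ * Real.Gamma (2 - α)) ^ (1 / α))
    (φ : ℕ → GridFun M) (hφ : IsL1Solution (L / M) α κ ε t N φ) :
    ∀ n, 1 ≤ n → n ≤ N →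
      backwardDiffQuot t (variationalEnergy (L / M) α κ ε t φ) n ≤ 0 := by
  intro n hn hnN
  have hmono : ∀ i j, i ≤ j → j ≤ N → t i ≤ t j := by
    intro i j hij
    induction j, hij using Nat.le_induction with
    | base => exact fun _ => le_rfl
    | succ j hij ih =>
      exact fun hj => (ih (by omega)).trans (by simpa using (htlt (j + 1) (by omega) hj).le)
  have hpos : ∀ j k, 1 ≤ k → k ≤ j → j ≤ n → 0 < l1Kernel α t j k := fun j k hk hkj hjn =>
    l1Kernel_pos hα1 (htlt k hk (by omega)) (hmono k j hkj (by omega))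
  have hθ : ∀ k, 1 ≤ k → k < n → docKernel (l1Kernel α t) n k ≤ 0 := fun k hk hkn =>
    docKernel_nonpos _ hpos (fun j k hk hkj hjn =>
      l1Kernel_mul_le_mul hα0 hα1 (htlt k hk (by omega))
        (by simpa using htlt (k + 1) (by omega) (by omega))
        (hmono _ _ hkj (by omega)) (hmono _ _ hjn.le hnN)) hk hkn
  have hsum : 0 ≤ ∑ j ∈ Finset.Icc 1 n, docKernel (l1Kernel α t) n j :=
    sum_docKernel_nonneg _ hn hpos (fun j hj hjn =>
      l1Kernel_anti hα0 hα1 (htlt 1 le_rfl (by omega)) (hmono _ _ hj (by omega))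
        (hmono _ _ hjn.le hnN)) hθ
  have hτ : 0 < timeStep t n := sub_pos.mpr (htlt n hn hnN)
  have hθn : κ * docKernel (l1Kernel α t) n n ≤ 1 := by
    rw [docKernel_self, l1Kernel_self hα1 (htlt n hn hnN), one_div_one_div]
    exact mul_Gamma_mul_rpow_le_one hα0 hα1 hκ hτ.le (hstep n hn hnN)
  have hinc : ∀ x, φ n x - φ (n - 1) x =
      -κ * ∑ j ∈ Finset.Icc 1 n,
        docKernel (l1Kernel α t) n j * potential (L / M) ε (φ j) x := fun x => by
    rw [← sum_docKernel_mul_sum (l1Kernel α t) (fun k => φ k x - φ (k - 1) x) hn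
      fun k hk hkn => (hpos k k hk le_rfl hkn).ne', Finset.mul_sum]
    refine Finset.sum_congr rfl fun j hj => ?_
    rw [Finset.mem_Icc] at hj
    have := hφ j hj.1 (by omega) x
    rw [l1Derivative] at this
    rw [this]
    ring
  refine div_nonpos_of_nonpos_of_nonneg ?_ hτ.le
  -- The weights do not depend on the node, so the scalar inequality can be summed over the grid.
  have hdiss : (L / M) ^ 2 * ∑ x, (potential (L / M) ε (φ n) x * (φ n x - φ (n - 1) x) +
      (φ n x - φ (n - 1) x) ^ 2 / 2 + κ / 2 * ∑ j ∈ Finset.Icc 1 n,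
        docKernel (l1Kernel α t) n j * potential (L / M) ε (φ j) x ^ 2) ≤ 0 :=
    mul_nonpos_of_nonneg_of_nonpos (sq_nonneg _) (Finset.sum_nonpos fun x _ =>
      dissipation_of_weights hκ hn _ (fun j => potential (L / M) ε (φ j) x) hθ hsum hθn (hinc x))
  have hμ : ∑ j ∈ Finset.Icc 1 n,
      docKernel (l1Kernel α t) n j * gridNorm (L / M) (potential (L / M) ε (φ j)) ^ 2 =
      (L / M) ^ 2 * ∑ x, ∑ j ∈ Finset.Icc 1 n,
        docKernel (l1Kernel α t) n j * potential (L / M) ε (φ j) x ^ 2 := by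
    rw [Finset.sum_comm, Finset.mul_sum]
    refine Finset.sum_congr rfl fun j _ => ?_
    rw [gridNorm_sq, ← Finset.mul_sum]
    ring
  have hE := freeEnergy_sub_le (L / M) ε (φ n) (φ (n - 1))
  have hP := sum_dccKernel_mul_sub (l1Kernel α t)
    (fun j => gridNorm (L / M) (potential (L / M) ε (φ j)) ^ 2) hn
  rw [hμ] at hP
  rw [Finset.sum_add_distrib, ← Finset.mul_sum, mul_add] at hdiss
  simp only [variationalEnergy]
  linear_combination hE + hdiss + κ / 2 * hP
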